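/- Let $n\ge 3$ be an integer and let $p$ be an odd prime such that the class of $2$ generates the unit group $U(\mathbb{Z}_{p^2})$ of $\mathbb{Z}/p^2\mathbb{Z}$. Let $G=\langle a\rangle\times\langle b\rangle$ be an abelian group with $o(a)=p^n$ and $o(b)=p$ (so $G\cong C_{p^n}\times C_p$). A minimal code of $\mathbb{F}_2G$ is a minimal nonzero ideal of $\mathbb{F}_2G$; its dimension is its dimension over $\mathbb{F}_2$, and its weight is the minimum number of nonzero coefficients of its nonzero elements. Two ideals are $G$-equivalent if the linear extension to $\mathbb{F}_2G$ of some automorphism of $G$ maps the one onto the other. For a subgroup $H\le G$ put $\widehat H=\frac{1}{|H|}\sum_{h\in H}h\in\mathbb{F}_2G$, for $x\in G$ put $\widehat x=\widehat{\langle x\rangle}$, and let $(e)$ denote the ideal generated by $e$. Then the minimal codes of $\mathbb{F}_2G$ are exactly the following: 1. $I_0=(\widehat G)$, of dimension $1$ and weight $p^{n+1}$; 2. $I_k=\bigl(\widehat{\langle a^{p^k}\rangle\times\langle b\rangle}-\widehat{\langle a^{p^{k-1}}\rangle\times\langle b\rangle}\bigr)$ for $1\le k\le n$, of dimension $p^{k-1}(p-1)$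 and weight $2p^{n-k+1}$; 3. $I_{1i}=\bigl(\widehat{ab^i}-\widehat G\bigr)$ for $0\le i\le p-1$, of dimension $p-1$ and weight $2p^n$; 4. $I_{ki}=\bigl(\widehat{a^{p^{k-1}}b^i}-\widehat{\langle a^{p^{k-1}}\rangle\times\langle b\rangle}\bigr)$ for $2\le k\le n$ and $1\le i\le p-1$, of dimension $p^{k-1}(p-1)$ and weight $2p^{n-k+1}$. There are exactly $2n$ $G$-equivalence classes of minimal codes of $\mathbb{F}_2G$. In particular, $G$ is a finite abelian group of odd order for which the number of $G$-equivalence classes of minimal codes of $\mathbb{F}_2G$ differs from the number $\tau(m)$ of positive divisors of the exponent $m$ of $G$, so $G$ is a counterexample to the assertion (Miller's Theorem A) that for every finite abelian group of odd order these two numbers are equal. -/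

import Mathlib

/-- A code of length `|G|` in the group algebra: an ideal of `F[G]`. -/
abbrev GroupCode (F G : Type*) [Field F] [CommGroup G] : Type _ :=
  Ideal (MonoidAlgebra F G)

/-- The element `|H|⁻¹ ∑_{h ∈ H} h` of the group algebra, for a (finite) subgroup `H`. -/
noncomputable def subgroupHat (F : Type*) {G : Type*} [Field F] [CommGroup G]
    (H : Subgroup G) : MonoidAlgebra F G :=
  (Nat.card H : F)⁻¹ • ∑ᶠ h : H, MonoidAlgebra.of F G (h : G)

/-- A minimal code: a minimal nonzero ideal of the group algebra. -/
def IsMinimalCode {F G : Type*} [Field F] [CommGroup G] (I : GroupCode F G) : Prop :=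
  IsAtom I

/-- Two codes are `G`-equivalent if the linear extension of some automorphism of the group `G`
maps the first onto the second. -/
def GEquivalent {F G : Type*} [Field F] [CommGroup G] (I J : GroupCode F G) : Prop :=
  ∃ ψ : G ≃* G, MonoidAlgebra.domCongr F F ψ '' (I : Set (MonoidAlgebra F G)) = J

/-- The number of nonzero coefficients of an element of the group algebra. -/
noncomputable def hammingWeight {F G : Type*} [Field F] [CommGroup G]
    (x : MonoidAlgebra F G) : ℕ :=
  x.coeff.support.card

/-- The weight of the code `I` is `w`: the minimum of the Hamming weights of the nonzero elements
of `I` is attained and equals `w`. -/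
def HasCodeWeight {F G : Type*} [Field F] [CommGroup G] (I : GroupCode F G) (w : ℕ) : Prop :=
  IsLeast {m : ℕ | ∃ x ∈ I, x ≠ 0 ∧ hammingWeight x = m} w

theorem GEquivalent.equivalence (F G : Type*) [Field F] [CommGroup G] :
    Equivalence (GEquivalent (F := F) (G := G)) where
  refl I := ⟨MulEquiv.refl G, by simp⟩
  symm := by
    rintro I J ⟨ψ, h⟩
    refine ⟨ψ.symm, ?_⟩
    rw [← h, ← MonoidAlgebra.domCongr_symm, Set.image_image]
    exact (Set.image_congr fun x _ =>
      (MonoidAlgebra.domCongr F F ψ).symm_apply_apply x).trans (Set.image_id' _)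
  trans := by
    rintro I J K ⟨ψ, h⟩ ⟨φ, h'⟩
    refine ⟨ψ.trans φ, ?_⟩
    rw [← h', ← h, Set.image_image]
    refine Set.image_congr fun x _ => ?_
    ext g
    simp

/-- `G`-equivalence as an equivalence relation on the set of minimal codes of `F[G]`. -/
def minimalCodeSetoid (F G : Type*) [Field F] [CommGroup G] :
    Setoid {I : GroupCode F G // IsMinimalCode I} :=
  ⟨fun I J => GEquivalent I.1 J.1,
    (GEquivalent.equivalence F G).comap Subtype.val⟩

/-- The number of `G`-equivalence classes of minimal codes of `F[G]`. -/
noncomputable def numMinimalCodeClasses (F G : Type*) [Field F] [CommGroup G] : ℕ :=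
  Nat.card (Quotient (minimalCodeSetoid F G))

/-- The code generated by `Ĥ`, where `H` is the whole group. -/
noncomputable def codeZero (G : Type*) [CommGroup G] : GroupCode (ZMod 2) G :=
  Ideal.span {subgroupHat (ZMod 2) (⊤ : Subgroup G)}

/-- The code generated by `Ĥ - K̂`, where `H = ⟨a ^ p ^ k⟩⟨b⟩` and `K = ⟨a ^ p ^ (k - 1)⟩⟨b⟩`
(used for `k ≥ 1`). -/
noncomputable def codeK {G : Type*} [CommGroup G] (p : ℕ) (a b : G) (k : ℕ) :
    GroupCode (ZMod 2) G :=
  Ideal.span {subgroupHat (ZMod 2) (Subgroup.zpowers (a ^ p ^ k) ⊔ Subgroup.zpowers b) -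
    subgroupHat (ZMod 2) (Subgroup.zpowers (a ^ p ^ (k - 1)) ⊔ Subgroup.zpowers b)}

/-- The code generated by `Ĥ - K̂`, where `H = ⟨a ^ p ^ (k - 1) * b ^ i⟩` and
`K = ⟨a ^ p ^ (k - 1)⟩⟨b⟩` (used for `k ≥ 1`). -/
noncomputable def codeKI {G : Type*} [CommGroup G] (p : ℕ) (a b : G) (k i : ℕ) :
    GroupCode (ZMod 2) G :=
  Ideal.span {subgroupHat (ZMod 2) (Subgroup.zpowers (a ^ p ^ (k - 1) * b ^ i)) -
    subgroupHat (ZMod 2) (Subgroup.zpowers (a ^ p ^ (k - 1)) ⊔ Subgroup.zpowers b)}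

/-! Since 2 is a primitive root modulo `p ^ 2`, it is one modulo every power of `p`, so every
cyclotomic polynomial Φ of order `p ^ (k + 1)` is irreducible over F₂
(`irreducible_cyclotomic_zmod_two`).

Let G/H be cyclic of order `p ^ (k + 1)`, generated by the image of x, let K/H be its subgroup of
order p, and put e = Ĥ - K̂ (`IsCocyclicPair`). Then f ↦ f(x)e maps F₂[X] onto the ideal (e) with
kernel (Φ). Hence (e) is a copy of the field F₂[X]/(Φ), which gives minimality and dimension.
Elements of (e) are H-invariant and have augmentation 0, so their weights are multiples of 2|H|;
this bound is attained.

Conversely, the annihilator of a minimal ideal I is prime. If N is the subgroup of G acting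
trivially on I, then K̂ kills I whenever K is not inside N, so I = (Ĥ - K̂) as soon as H ≤ N and K ≰
N (`eq_span_of_le_fixingGroup`). Locating a and b relative to N produces such a listed pair, or N =
G (`eq_of_isMinimalCode`).

Automorphisms sending a and b to suitable elements identify codes of equal dimension. Dimension
separates the levels k, and for k < n the groups N, of different exponents, separate two classes at
level k; at k = n these merge. This leaves 1 + n + (n - 1) = 2n classes, against n + 1 divisors of
the exponent. -/

/-! ### The order of 2 modulo prime powers, and irreducibility of cyclotomic polynomials. -/

theorem orderOf_two_of_generates_prime_sq {p : ℕ} (hp : p.Prime) (u : (ZMod (p ^ 2))ˣ)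
    (hu : (u : ZMod (p ^ 2)) = 2) (hgen : Subgroup.zpowers u = ⊤) :
    orderOf (2 : ZMod (p ^ 2)) = p * (p - 1) := by
  have : Fact p.Prime := ⟨hp⟩
  rw [← hu, orderOf_units, ← Nat.card_zpowers, hgen, Subgroup.card_top, Nat.card_eq_fintype_card,
    ZMod.card_units_eq_totient, Nat.totient_prime_pow hp (by norm_num)]
  simp

/-- Write `2 ^ (p - 1) = 1 + p * c`. Then p does not divide c, as otherwise the order modulo `p ^ 2`
would divide `p - 1`; hence `1 + p * c` has order `p ^ k`. The coprime factors `p ^ k` and `p - 1`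
are then treated separately. -/
theorem orderOf_two_zmod_prime_pow {p : ℕ} (hp : p.Prime) (hodd : Odd p)
    (h2 : orderOf (2 : ZMod (p ^ 2)) = p * (p - 1)) (k : ℕ) :
    orderOf (2 : ZMod (p ^ (k + 1))) = p ^ k * (p - 1) := by
  have hp2 : p ≠ 2 := by rintro rfl; exact absurd hodd (by decide)
  have h1p : 1 < p := hp.one_lt
  have hcast (m N : ℕ) : (2 : ZMod N) ^ m = 1 ↔ (N : ℤ) ∣ 2 ^ m - 1 := by
    rw [← ZMod.intCast_zmod_eq_zero_iff_dvd]
    push_cast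
    rw [sub_eq_zero]
  have hcop : (2 : ℕ).Coprime p := (Nat.coprime_primes Nat.prime_two hp).2 (Ne.symm hp2)
  have hfer : (p : ℤ) ∣ 2 ^ (p - 1) - 1 := by
    rw [← hcast]
    have : Fact p.Prime := ⟨hp⟩
    apply ZMod.pow_card_sub_one_eq_one
    have := (ZMod.isUnit_iff_coprime 2 p).2 hcop
    simpa using this.ne_zero
  obtain ⟨c, hc⟩ := hfer
  have hpc : ¬ (p : ℤ) ∣ c := by
    rintro ⟨d, rfl⟩
    have : orderOf (2 : ZMod (p ^ 2)) ∣ p - 1 := by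
      rw [orderOf_dvd_iff_pow_eq_one, hcast]
      exact ⟨d, by rw [hc]; push_cast; ring⟩
    rw [h2] at this
    have := Nat.le_of_dvd (by omega) this
    have : 2 * (p - 1) ≤ p * (p - 1) := Nat.mul_le_mul_right _ h1p
    omega
  have hpow := ZMod.orderOf_one_add_mul_prime hp hp2 c hpc k
  have hpow' : (1 + p * c : ZMod (p ^ (k + 1))) = 2 ^ (p - 1) := by
    have : (2 : ℤ) ^ (p - 1) = 1 + p * c := by rw [← hc]; ring
    have := congrArg (Int.cast : ℤ → ZMod (p ^ (k + 1))) this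
    push_cast at this
    exact this.symm
  rw [hpow'] at hpow
  apply Nat.dvd_antisymm
  · rw [orderOf_dvd_iff_pow_eq_one, mul_comm, pow_mul, ← hpow, pow_orderOf_eq_one]
  · apply Nat.Coprime.mul_dvd_of_dvd_of_dvd
    · apply Nat.Coprime.pow_left
      exact (Nat.coprime_self_sub_right h1p.le).2 (Nat.coprime_one_right p)
    · rw [← hpow]
      exact orderOf_pow_dvd _
    -- With d the order, `2 ^ d` is 1 modulo p, so `2 ^ (p * d)` is 1 modulo `p ^ 2`, and `p * (p -
    -- 1)` divides `p * d`.
    · have hd : (p : ℤ) ∣ 2 ^ orderOf (2 : ZMod (p ^ (k + 1))) - 1 := by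
        have := (hcast _ _).1 (pow_orderOf_eq_one (2 : ZMod (p ^ (k + 1))))
        exact (Dvd.intro_left ((p : ℤ) ^ k) (by push_cast; ring)).trans this
      have hd2 : ((p ^ 2 : ℕ) : ℤ) ∣ 2 ^ (p * orderOf (2 : ZMod (p ^ (k + 1)))) - 1 := by
        have := dvd_sub_pow_of_dvd_sub hd 1
        rw [mul_comm, pow_mul]
        simpa using this
      rw [← hcast, ← orderOf_dvd_iff_pow_eq_one, h2] at hd2
      exact Nat.dvd_of_mul_dvd_mul_left hp.pos hd2

/-- Irreducible factors of Φ over F₂ have degree the order of 2, which here is the full degree of Φ.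
-/
theorem irreducible_cyclotomic_zmod_two {p : ℕ} (hp : p.Prime) (hodd : Odd p)
    (h2 : orderOf (2 : ZMod (p ^ 2)) = p * (p - 1)) (k : ℕ) :
    Irreducible (Polynomial.cyclotomic (p ^ (k + 1)) (ZMod 2)) := by
  have hndvd : ¬ 2 ∣ p ^ (k + 1) := by
    rw [← even_iff_two_dvd, Nat.not_even_iff_odd]
    exact hodd.pow
  refine ZMod.irreducible_of_dvd_cyclotomic_of_natDegree hndvd dvd_rfl ?_
  rw [Polynomial.natDegree_cyclotomic, Nat.totient_prime_pow_succ hp, ← orderOf_units,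
    ZMod.coe_unitOfCoprime, ← orderOf_two_zmod_prime_pow hp hodd h2]
  rfl

/-! ### Subgroup idempotents and Hamming weights over F₂. -/

section SubgroupHat

variable {G : Type*} [CommGroup G]

theorem natCast_card_subgroup_eq_one (hG : Odd (Nat.card G)) (H : Subgroup G) :
    (Nat.card H : ZMod 2) = 1 := by
  have : Odd (Nat.card H) := hG.of_dvd_nat H.card_subgroup_dvd_card
  exact (ZMod.natCast_eq_one_iff_odd).2 this

theorem coeff_of_mul {F : Type*} [Field F] (g x : G) (y : MonoidAlgebra F G) :
    (MonoidAlgebra.of F G g * y).coeff x = y.coeff (g⁻¹ * x) := by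
  simp

/-- The sum of the coefficients of `y` is the parity of its Hamming weight. -/
theorem sum_coeff_eq_hammingWeight (y : MonoidAlgebra (ZMod 2) G) :
    (y.coeff.sum fun _ r => r) = (hammingWeight y : ZMod 2) := by
  rw [Finsupp.sum, hammingWeight, Finset.sum_congr rfl (g := fun _ => 1), Finset.sum_const,
    nsmul_one]
  intro g hg
  have := Finsupp.mem_support_iff.1 hg
  exact Fin.eq_one_of_ne_zero _ this

theorem mul_mem_support_of_fixed {H : Subgroup G} {y : MonoidAlgebra (ZMod 2) G}
    (hy : ∀ h ∈ H, MonoidAlgebra.of (ZMod 2) G h * y = y) {h g : G} (hh : h ∈ H)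
    (hg : g ∈ y.coeff.support) : h * g ∈ y.coeff.support := by
  rw [Finsupp.mem_support_iff] at hg ⊢
  rwa [← hy h hh, coeff_of_mul, inv_mul_cancel_left]

theorem subgroupHat_zmod_two (hG : Odd (Nat.card G)) (H : Subgroup G) :
    subgroupHat (ZMod 2) H = ∑ᶠ h : H, MonoidAlgebra.of (ZMod 2) G (h : G) := by
  rw [subgroupHat, natCast_card_subgroup_eq_one hG, inv_one, one_smul]

/-- The subgroup of the elements of `G` that act trivially on a set of elements of `F[G]`. -/
def fixingGroup {F : Type*} [Field F] (S : Set (MonoidAlgebra F G)) : Subgroup G where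
  carrier := {g | ∀ y ∈ S, MonoidAlgebra.of F G g * y = y}
  one_mem' y _ := by rw [map_one, one_mul]
  mul_mem' {g h} hg hh y hy := by rw [map_mul, mul_assoc, hh y hy, hg y hy]
  inv_mem' {g} hg y hy := by
    conv_lhs => rw [← hg y hy]
    rw [← mul_assoc, ← map_mul, inv_mul_cancel, map_one, one_mul]

theorem mem_fixingGroup {F : Type*} [Field F] {S : Set (MonoidAlgebra F G)} {g : G} :
    g ∈ fixingGroup S ↔ ∀ y ∈ S, MonoidAlgebra.of F G g * y = y :=
  Iff.rfl

/-- The support of an H-invariant element is a union of cosets of H. -/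
theorem card_subgroup_dvd_hammingWeight {H : Subgroup G} {y : MonoidAlgebra (ZMod 2) G}
    (hy : ∀ h ∈ H, MonoidAlgebra.of (ZMod 2) G h * y = y) :
    Nat.card H ∣ hammingWeight y := by
  let S : Set G := y.coeff.support
  let T : Set (G ⧸ H) := QuotientGroup.mk '' S
  have hST : QuotientGroup.mk ⁻¹' T = S := by
    ext g
    constructor
    · rintro ⟨s, hs, hsg⟩
      have : s⁻¹ * g ∈ H := QuotientGroup.eq.1 hsg
      have := mul_mem_support_of_fixed hy this hs
      simpa [S] using this
    · exact fun h => ⟨g, h, rfl⟩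
  have hc := Nat.card_congr (QuotientGroup.preimageMkEquivSubgroupProdSet H T)
  rw [hST, Nat.card_prod] at hc
  rw [hammingWeight, ← Nat.card_eq_finsetCard]
  exact ⟨_, hc⟩

variable [Finite G]

theorem of_mul_subgroupHat {H : Subgroup G} {g : G} (hg : g ∈ H) :
    MonoidAlgebra.of (ZMod 2) G g * subgroupHat (ZMod 2) H = subgroupHat (ZMod 2) H := by
  have := Fintype.ofFinite H
  rw [subgroupHat, mul_smul_comm, finsum_eq_sum_of_fintype, Finset.mul_sum]
  congr 1
  refine Fintype.sum_equiv (Equiv.mulLeft ⟨g, hg⟩) _ _ fun h => ?_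
  simp

theorem subgroupHat_mul_of_fixed (hG : Odd (Nat.card G)) {H : Subgroup G}
    {y : MonoidAlgebra (ZMod 2) G} (hy : ∀ h ∈ H, MonoidAlgebra.of (ZMod 2) G h * y = y) :
    subgroupHat (ZMod 2) H * y = y := by
  have := Fintype.ofFinite H
  rw [subgroupHat_zmod_two hG, finsum_eq_sum_of_fintype, Finset.sum_mul,
    Finset.sum_congr rfl fun (h : H) _ => hy h h.2, Finset.sum_const, Finset.card_univ,
    ← Nat.card_eq_fintype_card, ← Nat.cast_smul_eq_nsmul (ZMod 2),
    natCast_card_subgroup_eq_one hG, one_smul]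

theorem subgroupHat_mul_subgroupHat (hG : Odd (Nat.card G)) {H K : Subgroup G} (hHK : H ≤ K) :
    subgroupHat (ZMod 2) H * subgroupHat (ZMod 2) K = subgroupHat (ZMod 2) K :=
  subgroupHat_mul_of_fixed hG fun _ h => of_mul_subgroupHat (hHK h)

open Classical in
theorem coeff_subgroupHat (hG : Odd (Nat.card G)) (H : Subgroup G) (g : G) :
    (subgroupHat (ZMod 2) H).coeff g = if g ∈ H then 1 else 0 := by
  have := Fintype.ofFinite H
  rw [subgroupHat_zmod_two hG, finsum_eq_sum_of_fintype, MonoidAlgebra.coeff_sum,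
    Finsupp.finsetSum_apply]
  simp only [MonoidAlgebra.of_apply, MonoidAlgebra.coeff_single,
    Finsupp.single_apply]
  split_ifs with hg
  · rw [Finset.sum_eq_single ⟨g, hg⟩] <;> simp +contextual [Subtype.ext_iff]
  · refine Finset.sum_eq_zero fun h _ => if_neg ?_
    rintro rfl
    exact hg h.2

/-- The augmentation sends K̂ to 1, because |K| is odd, and sends y to the parity of its weight. -/
theorem even_hammingWeight_of_subgroupHat_mul_eq_zero (hG : Odd (Nat.card G)) {K : Subgroup G}
    {y : MonoidAlgebra (ZMod 2) G} (hy : subgroupHat (ZMod 2) K * y = 0) :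
    Even (hammingWeight y) := by
  let aug : MonoidAlgebra (ZMod 2) G →ₐ[ZMod 2] ZMod 2 := MonoidAlgebra.lift (ZMod 2) (ZMod 2) G 1
  have haug (z : MonoidAlgebra (ZMod 2) G) : aug z = (hammingWeight z : ZMod 2) := by
    rw [← sum_coeff_eq_hammingWeight]
    simp [aug, MonoidAlgebra.lift_apply]
  have hK : aug (subgroupHat (ZMod 2) K) = 1 := by
    have := Fintype.ofFinite K
    rw [subgroupHat_zmod_two hG, finsum_eq_sum_of_fintype, map_sum]
    simp only [aug, MonoidAlgebra.lift_of, MonoidHom.one_apply, Finset.sum_const, nsmul_one,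
      Finset.card_univ]
    rw [← Nat.card_eq_fintype_card, natCast_card_subgroup_eq_one hG]
  have := congrArg aug hy
  rw [map_mul, hK, one_mul, map_zero, haug] at this
  exact (ZMod.natCast_eq_zero_iff_even).1 this

theorem hammingWeight_subgroupHat (hG : Odd (Nat.card G)) (H : Subgroup G) :
    hammingWeight (subgroupHat (ZMod 2) H) = Nat.card H := by
  rw [hammingWeight, ← Nat.card_eq_finsetCard]
  refine Nat.card_congr (Equiv.subtypeEquivRight fun g => ?_)
  classical
  rw [Finsupp.mem_support_iff, coeff_subgroupHat hG]
  simp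

theorem hammingWeight_sub_of_mul_subgroupHat_le (hG : Odd (Nat.card G)) (H : Subgroup G) (g : G) :
    hammingWeight (subgroupHat (ZMod 2) H - MonoidAlgebra.of (ZMod 2) G g * subgroupHat (ZMod 2) H)
      ≤ 2 * Nat.card H := by
  classical
  have h1 := hammingWeight_subgroupHat hG H
  have h2 : hammingWeight (MonoidAlgebra.of (ZMod 2) G g * subgroupHat (ZMod 2) H) ≤
      Nat.card H := by
    rw [← h1, hammingWeight, hammingWeight]
    exact (Finset.card_le_card (MonoidAlgebra.support_coeff_single_mul_subset _ _ _)).trans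
      Finset.card_image_le
  rw [hammingWeight] at h1 h2 ⊢
  rw [MonoidAlgebra.coeff_sub]
  refine (Finset.card_le_card Finsupp.support_sub).trans ((Finset.card_union_le _ _).trans ?_)
  omega

end SubgroupHat

/-! ### The ideal attached to a cyclic quotient: minimality, dimension, weight. -/

/-- Subgroups `H ≤ K` of `G` with `G = H⟨x⟩`, `G / H` cyclic of order `p ^ (k + 1)`, and `K / H`
the subgroup of order `p` of `G / H`. -/
structure IsCocyclicPair {G : Type*} [CommGroup G] (p k : ℕ) (H K : Subgroup G) (x : G) : Prop where
  sup_zpowers : H ⊔ Subgroup.zpowers x = ⊤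
  pow_notMem : x ^ p ^ k ∉ H
  pow_mem : x ^ p ^ (k + 1) ∈ H
  eq_sup : K = H ⊔ Subgroup.zpowers (x ^ p ^ k)

namespace IsCocyclicPair

variable {G : Type*} [CommGroup G] {p k : ℕ} {H K : Subgroup G} {x : G}

theorem le (h : IsCocyclicPair p k H K x) : H ≤ K := h.eq_sup ▸ le_sup_left

theorem pow_mem_right (h : IsCocyclicPair p k H K x) : x ^ p ^ k ∈ K :=
  h.eq_sup ▸ (le_sup_right : _ ≤ H ⊔ _) (Subgroup.mem_zpowers _)

theorem of_mul_sub [Finite G] {g : G} (h : IsCocyclicPair p k H K x) (hg : g ∈ H) :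
    MonoidAlgebra.of (ZMod 2) G g * (subgroupHat (ZMod 2) H - subgroupHat (ZMod 2) K) =
      subgroupHat (ZMod 2) H - subgroupHat (ZMod 2) K := by
  rw [mul_sub, of_mul_subgroupHat hg, of_mul_subgroupHat (h.le hg)]

open Polynomial

variable [Finite G]

/-- Here Φ(x) = s is the sum of the `t ^ i` for i < p, where `t = x ^ p ^ k`. As p is odd, sK̂ = pK̂
= K̂. Since sĤ is fixed by H and t, it is K-invariant, so sĤ = K̂sĤ = sK̂ as well. -/
theorem aeval_cyclotomic_mul_eq_zero (h : IsCocyclicPair p k H K x) (hG : Odd (Nat.card G))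
    (hp : p.Prime) (hodd : Odd p) :
    aeval (MonoidAlgebra.of (ZMod 2) G x) (cyclotomic (p ^ (k + 1)) (ZMod 2)) *
      (subgroupHat (ZMod 2) H - subgroupHat (ZMod 2) K) = 0 := by
  rw [cyclotomic_prime_pow_eq_geom_sum hp, map_sum]
  simp only [map_pow, aeval_X]
  set t := MonoidAlgebra.of (ZMod 2) G x ^ p ^ k with ht
  have htK : t * subgroupHat (ZMod 2) K = subgroupHat (ZMod 2) K := by
    rw [ht, ← map_pow]
    exact of_mul_subgroupHat h.pow_mem_right
  have htp : t ^ p * subgroupHat (ZMod 2) H = subgroupHat (ZMod 2) H := by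
    rw [ht, ← map_pow, ← map_pow, ← pow_mul, ← pow_succ]
    exact of_mul_subgroupHat h.pow_mem
  have hsK : (∑ i ∈ Finset.range p, t ^ i) * subgroupHat (ZMod 2) K = subgroupHat (ZMod 2) K := by
    have hi (i : ℕ) : t ^ i * subgroupHat (ZMod 2) K = subgroupHat (ZMod 2) K := by
      induction i with
      | zero => simp
      | succ i ih => rw [pow_succ, mul_assoc, htK, ih]
    rw [Finset.sum_mul, Finset.sum_congr rfl fun i _ => hi i, Finset.sum_const, Finset.card_range,
      ← Nat.cast_smul_eq_nsmul (ZMod 2), (ZMod.natCast_eq_one_iff_odd).2 hodd, one_smul]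
  set s := ∑ i ∈ Finset.range p, t ^ i
  have hfix : ∀ g ∈ K, MonoidAlgebra.of (ZMod 2) G g * (s * subgroupHat (ZMod 2) H) =
      s * subgroupHat (ZMod 2) H := by
    have hK : K ≤ fixingGroup {s * subgroupHat (ZMod 2) H} := by
      rw [h.eq_sup, sup_le_iff, Subgroup.zpowers_le, mem_fixingGroup]
      refine ⟨fun g hg => ?_, ?_⟩
      · rintro _ rfl
        rw [mul_left_comm, of_mul_subgroupHat hg]
      · rintro _ rfl
        rw [map_pow, ← ht, ← sub_eq_zero, ← mul_assoc]
        calc t * s * subgroupHat (ZMod 2) H - s * subgroupHat (ZMod 2) H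
            = (s * (t - 1)) * subgroupHat (ZMod 2) H := by ring
          _ = 0 := by rw [geom_sum_mul, sub_mul, htp, one_mul, sub_self]
    exact fun g hg => hK hg _ rfl
  rw [mul_sub, hsK, sub_eq_zero, ← subgroupHat_mul_of_fixed hG hfix, mul_left_comm,
    mul_comm _ (subgroupHat (ZMod 2) H),
    subgroupHat_mul_subgroupHat hG h.le, hsK]

theorem sub_ne_zero (h : IsCocyclicPair p k H K x) (hG : Odd (Nat.card G)) :
    subgroupHat (ZMod 2) H - subgroupHat (ZMod 2) K ≠ 0 := by
  classical
  intro h0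
  have := congrArg (fun y => MonoidAlgebra.coeff y (x ^ p ^ k)) h0
  simp [coeff_subgroupHat hG, h.pow_notMem, h.pow_mem_right] at this

/-- Every group element is a power of x times an element of H, and H acts trivially on Ĥ - K̂. -/
theorem exists_aeval_mul_sub_eq (h : IsCocyclicPair p k H K x) (y : MonoidAlgebra (ZMod 2) G) :
    ∃ f : (ZMod 2)[X], aeval (MonoidAlgebra.of (ZMod 2) G x) f *
      (subgroupHat (ZMod 2) H - subgroupHat (ZMod 2) K) =
      y * (subgroupHat (ZMod 2) H - subgroupHat (ZMod 2) K) := by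
  induction y using MonoidAlgebra.induction_on with
  | of g =>
    have hg : g ∈ H ⊔ Subgroup.zpowers x := h.sup_zpowers ▸ Subgroup.mem_top g
    obtain ⟨u, hu, v, hv, rfl⟩ := Subgroup.mem_sup.1 hg
    obtain ⟨m, rfl⟩ := (mem_powers_iff_mem_zpowers).2 hv
    refine ⟨X ^ m, ?_⟩
    simp only [map_pow, aeval_X]
    rw [mul_comm u, map_mul, mul_assoc, h.of_mul_sub hu, map_pow]
  | add y z hy hz =>
    obtain ⟨f, hf⟩ := hy
    obtain ⟨g, hg⟩ := hz
    exact ⟨f + g, by rw [map_add, add_mul, hf, hg, add_mul]⟩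
  | smul r y hy =>
    obtain ⟨f, hf⟩ := hy
    exact ⟨r • f, by rw [map_smul, smul_mul_assoc, hf, smul_mul_assoc]⟩

theorem aeval_mul_sub_eq_zero_iff (h : IsCocyclicPair p k H K x) (hG : Odd (Nat.card G))
    (hp : p.Prime) (hodd : Odd p) (hirr : Irreducible (cyclotomic (p ^ (k + 1)) (ZMod 2)))
    (f : (ZMod 2)[X]) :
    aeval (MonoidAlgebra.of (ZMod 2) G x) f *
      (subgroupHat (ZMod 2) H - subgroupHat (ZMod 2) K) = 0 ↔
      cyclotomic (p ^ (k + 1)) (ZMod 2) ∣ f := by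
  have h0 := h.aeval_cyclotomic_mul_eq_zero hG hp hodd
  constructor
  · intro hf
    by_contra hdvd
    obtain ⟨r, s, hrs⟩ := (hirr.coprime_iff_not_dvd).2 hdvd
    apply h.sub_ne_zero hG
    have := congrArg (fun q => aeval (MonoidAlgebra.of (ZMod 2) G x) q *
      (subgroupHat (ZMod 2) H - subgroupHat (ZMod 2) K)) hrs
    simp only [map_add, map_mul, map_one, add_mul, mul_assoc, h0, hf, mul_zero, one_mul,
      add_zero] at this
    exact this.symm
  · rintro ⟨g, rfl⟩
    rw [map_mul, mul_right_comm, h0, zero_mul]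

/-- A nonzero element is f(x)e with f prime to Φ; a Bézout relation recovers e from it. -/
theorem isAtom (h : IsCocyclicPair p k H K x) (hG : Odd (Nat.card G))
    (hp : p.Prime) (hodd : Odd p) (hirr : Irreducible (cyclotomic (p ^ (k + 1)) (ZMod 2))) :
    IsAtom (Ideal.span {subgroupHat (ZMod 2) H - subgroupHat (ZMod 2) K}) := by
  refine ⟨?_, fun J hJ => ?_⟩
  · rw [Ne, Ideal.span_singleton_eq_bot]
    exact h.sub_ne_zero hG
  · by_contra hbot
    refine hJ.not_ge ?_
    obtain ⟨y, hy, hy0⟩ := Submodule.exists_mem_ne_zero_of_ne_bot hbot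
    obtain ⟨z, rfl⟩ := Ideal.mem_span_singleton'.1 (hJ.le hy)
    obtain ⟨f, hf⟩ := h.exists_aeval_mul_sub_eq z
    rw [← hf] at hy hy0
    rw [Ne, h.aeval_mul_sub_eq_zero_iff hG hp hodd hirr, ← hirr.coprime_iff_not_dvd] at hy0
    obtain ⟨r, s, hrs⟩ := hy0
    rw [Ideal.span_singleton_le_iff_mem]
    have := congrArg (fun q => aeval (MonoidAlgebra.of (ZMod 2) G x) q *
      (subgroupHat (ZMod 2) H - subgroupHat (ZMod 2) K)) hrs
    simp only [map_add, map_mul, map_one, add_mul, mul_assoc, one_mul,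
      h.aeval_cyclotomic_mul_eq_zero hG hp hodd, mul_zero, zero_add] at this
    rw [← this]
    exact J.mul_mem_left _ hy

theorem finrank_span (h : IsCocyclicPair p k H K x) (hG : Odd (Nat.card G))
    (hp : p.Prime) (hodd : Odd p) (hirr : Irreducible (cyclotomic (p ^ (k + 1)) (ZMod 2))) :
    Module.finrank (ZMod 2) (Ideal.span {subgroupHat (ZMod 2) H - subgroupHat (ZMod 2) K}) =
      p ^ k * (p - 1) := by
  set e := subgroupHat (ZMod 2) H - subgroupHat (ZMod 2) K with he
  let φ : (ZMod 2)[X] →ₗ[ZMod 2] (Ideal.span {e}).restrictScalars (ZMod 2) :=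
    LinearMap.codRestrict _ (LinearMap.mulRight (ZMod 2) e ∘ₗ
      (aeval (MonoidAlgebra.of (ZMod 2) G x)).toLinearMap) fun f =>
      (Ideal.span {e}).mul_mem_left _ (Ideal.mem_span_singleton_self e)
  have hsurj : Function.Surjective φ := by
    rintro ⟨y, hy⟩
    obtain ⟨z, rfl⟩ := Ideal.mem_span_singleton'.1 hy
    obtain ⟨f, hf⟩ := h.exists_aeval_mul_sub_eq z
    exact ⟨f, Subtype.ext hf⟩
  have hker : LinearMap.ker φ =
      (Ideal.span {cyclotomic (p ^ (k + 1)) (ZMod 2)}).restrictScalars (ZMod 2) := by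
    ext f
    rw [LinearMap.mem_ker, Submodule.restrictScalars_mem, Ideal.mem_span_singleton,
      ← h.aeval_mul_sub_eq_zero_iff hG hp hodd hirr, ← Submodule.coe_eq_zero]
    rfl
  have e1 := (φ.quotKerEquivOfSurjective hsurj).finrank_eq
  rw [hker] at e1
  have e2 := (Submodule.Quotient.restrictScalarsEquiv (ZMod 2)
    (Ideal.span {cyclotomic (p ^ (k + 1)) (ZMod 2)})).finrank_eq
  rw [← Nat.totient_prime_pow_succ hp, ← natDegree_cyclotomic _ (ZMod 2),
    ← finrank_quotient_span_eq_natDegree]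
  exact e1.symm.trans e2

theorem hasCodeWeight (h : IsCocyclicPair p k H K x) (hG : Odd (Nat.card G)) :
    HasCodeWeight (Ideal.span {subgroupHat (ZMod 2) H - subgroupHat (ZMod 2) K})
      (2 * Nat.card H) := by
  set e := subgroupHat (ZMod 2) H - subgroupHat (ZMod 2) K with he
  have hKe : subgroupHat (ZMod 2) K * e = 0 := by
    rw [he, mul_sub, mul_comm, subgroupHat_mul_subgroupHat hG h.le,
      subgroupHat_mul_subgroupHat hG le_rfl, sub_self]
  have hlow : ∀ y ∈ Ideal.span {e}, y ≠ 0 → 2 * Nat.card H ≤ hammingWeight y := by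
    intro y hy hy0
    obtain ⟨z, rfl⟩ := Ideal.mem_span_singleton'.1 hy
    have h1 : Nat.card H ∣ hammingWeight (z * e) :=
      card_subgroup_dvd_hammingWeight fun g hg => by rw [mul_left_comm, h.of_mul_sub hg]
    have h2 : Even (hammingWeight (z * e)) :=
      even_hammingWeight_of_subgroupHat_mul_eq_zero hG (K := K) (by
        rw [mul_left_comm, hKe, mul_zero])
    have hH : Odd (Nat.card H) := hG.of_dvd_nat H.card_subgroup_dvd_card
    refine Nat.le_of_dvd ?_ ((Nat.coprime_two_left.2 hH).mul_dvd_of_dvd_of_dvd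
      (even_iff_two_dvd.1 h2) h1)
    rw [hammingWeight, Finset.card_pos, Finsupp.support_nonempty_iff]
    simpa using hy0
  refine ⟨?_, ?_⟩
  -- This is (1 - t)e with `t = x ^ p ^ k`, since t fixes K̂; its support is H ∪ tH.
  · let y := subgroupHat (ZMod 2) H -
      MonoidAlgebra.of (ZMod 2) G (x ^ p ^ k) * subgroupHat (ZMod 2) H
    have hy : y ∈ Ideal.span {e} := by
      refine Ideal.mem_span_singleton'.2 ⟨1 - MonoidAlgebra.of (ZMod 2) G (x ^ p ^ k), ?_⟩
      rw [sub_mul, one_mul, he, mul_sub, of_mul_subgroupHat h.pow_mem_right]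
      simp only [y]
      ring
    have hy0 : y ≠ 0 := by
      classical
      intro h0
      have := congrArg (fun y => MonoidAlgebra.coeff y 1) h0
      simp only [y, MonoidAlgebra.coeff_sub, Finsupp.sub_apply, coeff_of_mul,
        coeff_subgroupHat hG] at this
      simp [h.pow_notMem] at this
    exact ⟨y, hy, hy0, le_antisymm (hammingWeight_sub_of_mul_subgroupHat_le hG H _)
      (hlow y hy hy0)⟩
  · rintro m ⟨y, hy, hy0, rfl⟩
    exact hlow y hy hy0

/-- The code determines H, which is what distinguishes inequivalent codes of equal dimension. -/
theorem fixingGroup_span (h : IsCocyclicPair p k H K x) (hG : Odd (Nat.card G)) :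
    fixingGroup (Ideal.span {subgroupHat (ZMod 2) H - subgroupHat (ZMod 2) K} :
      Set (MonoidAlgebra (ZMod 2) G)) = H := by
  classical
  ext g
  rw [mem_fixingGroup]
  constructor
  · intro hg
    have hg := hg _ (Ideal.mem_span_singleton_self _)
    by_contra hgH
    -- If g ∉ H fixes e, coefficients at g exclude g ∈ K, because e vanishes at 1 but not on K \ H.
    -- Coefficients at `g * x ^ p ^ k` then exclude g ∉ K.
    have h1 := congrArg (fun y => MonoidAlgebra.coeff y g) hg
    have hgK : g ∉ K := by
      intro hgK
      simp [coeff_subgroupHat hG, hgH, hgK, -MonoidAlgebra.of_apply, coeff_of_mul] at h1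
    have h2 := congrArg (fun y => MonoidAlgebra.coeff y (g * x ^ p ^ k)) hg
    have hgt : g * x ^ p ^ k ∉ K := fun hK => hgK ((K.mul_mem_cancel_right h.pow_mem_right).1 hK)
    have hgt' : g * x ^ p ^ k ∉ H := fun hH => hgt (h.le hH)
    simp [coeff_subgroupHat hG, h.pow_notMem, h.pow_mem_right, hgt, hgt',
      -MonoidAlgebra.of_apply, coeff_of_mul] at h2
  · intro hg y hy
    obtain ⟨z, rfl⟩ := Ideal.mem_span_singleton'.1 hy
    rw [mul_left_comm, h.of_mul_sub hg]

end IsCocyclicPair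

theorem IsCocyclicPair.index_eq {G : Type*} [CommGroup G] {p k : ℕ} {H K : Subgroup G} {x : G}
    (h : IsCocyclicPair p k H K x) (hp : p.Prime) : H.index = p ^ (k + 1) := by
  have := Fact.mk hp
  have hord : orderOf (x : G ⧸ H) = p ^ (k + 1) := by
    apply orderOf_eq_prime_pow
    · rw [← QuotientGroup.mk_pow, QuotientGroup.eq_one_iff]
      exact h.pow_notMem
    · rw [← QuotientGroup.mk_pow, QuotientGroup.eq_one_iff]
      exact h.pow_mem
  have htop : Subgroup.zpowers (x : G ⧸ H) = ⊤ := by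
    have := congrArg (Subgroup.map (QuotientGroup.mk' H)) h.sup_zpowers
    rw [Subgroup.map_sup, MonoidHom.map_zpowers, Subgroup.map_top_of_surjective _
      (QuotientGroup.mk'_surjective H), QuotientGroup.map_mk'_self, bot_sup_eq] at this
    exact this
  rw [Subgroup.index, ← hord, ← Nat.card_zpowers, htop, Subgroup.card_top]

/-! ### Coordinates with respect to a and b, and the cocyclic pairs of the list. -/

section

variable {G : Type*} [CommGroup G] {n p : ℕ} {a b : G}

theorem mem_zpowers_sup_zpowers {x y g : G} :
    g ∈ Subgroup.zpowers x ⊔ Subgroup.zpowers y ↔ ∃ i j : ℤ, x ^ i * y ^ j = g := by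
  simp only [Subgroup.mem_sup, Subgroup.mem_zpowers_iff, exists_exists_eq_and]

theorem exists_zpow_mul_zpow_eq (hab : IsCompl (Subgroup.zpowers a) (Subgroup.zpowers b)) (g : G) :
    ∃ i j : ℤ, a ^ i * b ^ j = g :=
  mem_zpowers_sup_zpowers.1 (hab.sup_eq_top ▸ Subgroup.mem_top g)

theorem zpow_mul_zpow_eq_one_iff (hab : IsCompl (Subgroup.zpowers a) (Subgroup.zpowers b))
    (i j : ℤ) : a ^ i * b ^ j = 1 ↔ (orderOf a : ℤ) ∣ i ∧ (orderOf b : ℤ) ∣ j := by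
  rw [orderOf_dvd_iff_zpow_eq_one, orderOf_dvd_iff_zpow_eq_one]
  constructor
  · intro h
    have h1 : a ^ i = 1 := by
      have hb : a ^ i ∈ Subgroup.zpowers b := by
        rw [eq_inv_of_mul_eq_one_left h]
        exact inv_mem (Subgroup.zpow_mem _ (Subgroup.mem_zpowers b) j)
      exact Subgroup.disjoint_def.1 hab.disjoint
        (Subgroup.zpow_mem _ (Subgroup.mem_zpowers a) i) hb
    exact ⟨h1, by simpa [h1] using h⟩
  · rintro ⟨h1, h2⟩
    rw [h1, h2, one_mul]

theorem zpow_mul_zpow_eq_iff (hab : IsCompl (Subgroup.zpowers a) (Subgroup.zpowers b))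
    (i j i' j' : ℤ) : a ^ i * b ^ j = a ^ i' * b ^ j' ↔
      (orderOf a : ℤ) ∣ i - i' ∧ (orderOf b : ℤ) ∣ j - j' := by
  rw [← zpow_mul_zpow_eq_one_iff hab, ← mul_inv_eq_one, zpow_sub, zpow_sub, mul_inv,
    mul_mul_mul_comm]

theorem card_of_isCompl_zpowers (hab : IsCompl (Subgroup.zpowers a) (Subgroup.zpowers b)) :
    Nat.card G = orderOf a * orderOf b := by
  have h : Subgroup.IsComplement' (Subgroup.zpowers a) (Subgroup.zpowers b) := by
    refine Subgroup.isComplement'_of_disjoint_and_mul_eq_univ hab.disjoint ?_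
    rw [← Subgroup.mul_normal, hab.sup_eq_top, Subgroup.coe_top]
  rw [← h.card_mul_card, Nat.card_zpowers, Nat.card_zpowers]

end

section

variable {G : Type*} [CommGroup G] {n p : ℕ} {a b : G}

theorem isCocyclicPair_codeK (hp : p.Prime) (ha : orderOf a = p ^ n)
    (hab : IsCompl (Subgroup.zpowers a) (Subgroup.zpowers b)) {k : ℕ} (hk : k < n) :
    IsCocyclicPair p k (Subgroup.zpowers (a ^ p ^ (k + 1)) ⊔ Subgroup.zpowers b)
      (Subgroup.zpowers (a ^ p ^ k) ⊔ Subgroup.zpowers b) a where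
  sup_zpowers := by
    rw [eq_top_iff, ← hab.sup_eq_top]
    exact sup_le le_sup_right (le_sup_right.trans le_sup_left)
  pow_notMem := by
    rw [mem_zpowers_sup_zpowers]
    rintro ⟨i, j, h⟩
    have h' : a ^ ((p : ℤ) ^ (k + 1) * i) * b ^ j = a ^ ((p : ℤ) ^ k) * b ^ (0 : ℤ) := by
      rw [zpow_mul]
      exact_mod_cast (by simpa using h)
    rw [zpow_mul_zpow_eq_iff hab, ha] at h'
    have h1 : ((p : ℤ) ^ k * p) ∣ (p : ℤ) ^ k * (p * i - 1) := by
      have := h'.1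
      push_cast at this
      have := (pow_dvd_pow (p : ℤ) (show k + 1 ≤ n from hk)).trans this
      simpa only [pow_succ, mul_sub, mul_one, mul_assoc] using this
    have h2 := Int.dvd_of_mul_dvd_mul_left (pow_ne_zero k (by exact_mod_cast hp.ne_zero)) h1
    have h3 : (p : ℤ) ∣ 1 := (dvd_sub_right (Dvd.intro i rfl)).1 h2
    exact hp.one_lt.ne' (by exact_mod_cast Int.eq_one_of_dvd_one (by positivity) h3)
  pow_mem := Subgroup.mem_sup_left (Subgroup.mem_zpowers _)
  eq_sup := by
    apply le_antisymm
    · exact sup_le le_sup_right (le_sup_right.trans le_sup_left)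
    · refine sup_le (sup_le ?_ le_sup_right) le_sup_left
      rw [Subgroup.zpowers_le, pow_succ, pow_mul]
      exact Subgroup.mem_sup_left (Subgroup.pow_mem _ (Subgroup.mem_zpowers _) p)

theorem isCocyclicPair_codeKI_zero (hp : p.Prime) (hb : orderOf b = p)
    (hab : IsCompl (Subgroup.zpowers a) (Subgroup.zpowers b)) :
    IsCocyclicPair p 0 (Subgroup.zpowers a) (Subgroup.zpowers a ⊔ Subgroup.zpowers b) b where
  sup_zpowers := hab.sup_eq_top
  pow_notMem h := by
    have : b = 1 := Subgroup.disjoint_def.1 hab.disjoint (by simpa using h)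
      (Subgroup.mem_zpowers b)
    rw [this, orderOf_one] at hb
    exact hp.one_lt.ne hb
  pow_mem := by
    rw [zero_add, pow_one, ← hb, pow_orderOf_eq_one]
    exact one_mem _
  eq_sup := by simp

theorem zpowers_pow_eq_of_coprime {i : ℕ} (hi : (orderOf b).Coprime i) :
    Subgroup.zpowers (b ^ i) = Subgroup.zpowers b := by
  apply le_antisymm
  · rw [Subgroup.zpowers_le]
    exact Subgroup.pow_mem _ (Subgroup.mem_zpowers _) i
  · rw [Subgroup.zpowers_le]
    obtain ⟨m, hm⟩ := exists_pow_eq_self_of_coprime hi.symm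
    exact ⟨m, by simpa using hm⟩

/-- As i is prime to p, `b ^ i` generates ⟨b⟩, and modulo H it is the inverse of `a ^ p ^ k`; so a
alone generates the quotient. -/
theorem isCocyclicPair_codeKI (hp : p.Prime) (ha : orderOf a = p ^ n) (hb : orderOf b = p)
    (hab : IsCompl (Subgroup.zpowers a) (Subgroup.zpowers b)) {k i : ℕ} (hk : k < n)
    (hi : p.Coprime i) :
    IsCocyclicPair p k (Subgroup.zpowers (a ^ p ^ k * b ^ i))
      (Subgroup.zpowers (a ^ p ^ k) ⊔ Subgroup.zpowers b) a where
  sup_zpowers := by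
    rw [eq_top_iff, ← hab.sup_eq_top, ← zpowers_pow_eq_of_coprime (b := b) (hb.symm ▸ hi)]
    refine sup_le le_sup_right ?_
    rw [Subgroup.zpowers_le, ← Subgroup.mul_mem_cancel_left _ (x := a ^ p ^ k)]
    · exact Subgroup.mem_sup_left (Subgroup.mem_zpowers _)
    · exact Subgroup.mem_sup_right (Subgroup.pow_mem _ (Subgroup.mem_zpowers _) _)
  pow_notMem := by
    rintro ⟨m, h⟩
    have h' : a ^ ((p : ℤ) ^ k * m) * b ^ (i * m : ℤ) = a ^ ((p : ℤ) ^ k) * b ^ (0 : ℤ) := by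
      rw [zpow_mul, zpow_mul, ← mul_zpow]
      exact_mod_cast (by simpa using h)
    rw [zpow_mul_zpow_eq_iff hab, ha, hb, sub_zero] at h'
    have h1 : ((p : ℤ) ^ k * p) ∣ (p : ℤ) ^ k * (m - 1) := by
      have := h'.1
      push_cast at this
      have := (pow_dvd_pow (p : ℤ) (show k + 1 ≤ n from hk)).trans this
      simpa only [pow_succ, mul_sub, mul_one, mul_assoc] using this
    have h2 := Int.dvd_of_mul_dvd_mul_left (pow_ne_zero k (by exact_mod_cast hp.ne_zero)) h1
    have h3 : (p : ℤ) ∣ m := (Nat.isCoprime_iff_coprime.2 hi).dvd_of_dvd_mul_left h'.2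
    have h4 : (p : ℤ) ∣ 1 := (dvd_sub_right h3).1 h2
    exact hp.one_lt.ne' (by exact_mod_cast Int.eq_one_of_dvd_one (by positivity) h4)
  pow_mem := by
    refine ⟨p, ?_⟩
    simp only [zpow_natCast, mul_pow, ← pow_mul]
    rw [mul_comm i, pow_mul b, ← hb, pow_orderOf_eq_one, one_pow, mul_one, pow_succ]
  eq_sup := by
    nth_rw 1 [← zpowers_pow_eq_of_coprime (b := b) (hb.symm ▸ hi)]
    apply le_antisymm
    · refine sup_le le_sup_right ?_
      rw [Subgroup.zpowers_le, ← Subgroup.mul_mem_cancel_left _ (x := a ^ p ^ k)]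
      · exact Subgroup.mem_sup_left (Subgroup.mem_zpowers _)
      · exact Subgroup.mem_sup_right (Subgroup.mem_zpowers _)
    · refine sup_le ?_ le_sup_left
      rw [Subgroup.zpowers_le]
      exact Subgroup.mul_mem_sup (Subgroup.mem_zpowers _) (Subgroup.mem_zpowers _)

end

/-! ### The one-dimensional code. -/

section CodeZero

variable {G : Type*} [CommGroup G]

theorem subgroupHat_top_mem_codeZero : subgroupHat (ZMod 2) (⊤ : Subgroup G) ∈ codeZero G :=
  Ideal.mem_span_singleton_self _

variable [Finite G]

theorem mem_codeZero_iff {y : MonoidAlgebra (ZMod 2) G} :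
    y ∈ codeZero G ↔ ∃ c : ZMod 2, c • subgroupHat (ZMod 2) (⊤ : Subgroup G) = y := by
  rw [codeZero, Ideal.mem_span_singleton']
  constructor
  · rintro ⟨z, rfl⟩
    induction z using MonoidAlgebra.induction_on with
    | of g => exact ⟨1, by rw [of_mul_subgroupHat (Subgroup.mem_top g), one_smul]⟩
    | add y z hy hz =>
      obtain ⟨c, hc⟩ := hy
      obtain ⟨d, hd⟩ := hz
      exact ⟨c + d, by rw [add_smul, hc, hd, add_mul]⟩
    | smul r y hy =>
      obtain ⟨c, hc⟩ := hy
      exact ⟨r * c, by rw [mul_smul, hc, smul_mul_assoc]⟩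
  · rintro ⟨c, rfl⟩
    exact ⟨c • 1, by rw [smul_mul_assoc, one_mul]⟩

theorem subgroupHat_ne_zero (hG : Odd (Nat.card G)) (H : Subgroup G) :
    subgroupHat (ZMod 2) H ≠ 0 := by
  classical
  intro h0
  have := congrArg (fun y => MonoidAlgebra.coeff y 1) h0
  simp [coeff_subgroupHat hG] at this

theorem eq_subgroupHat_top_of_mem_codeZero {y : MonoidAlgebra (ZMod 2) G} (hy : y ∈ codeZero G)
    (hy0 : y ≠ 0) : y = subgroupHat (ZMod 2) (⊤ : Subgroup G) := by
  obtain ⟨c, rfl⟩ := mem_codeZero_iff.1 hy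
  have hc : c ≠ 0 := by
    rintro rfl
    exact hy0 (zero_smul _ _)
  rw [Fin.eq_one_of_ne_zero c hc]
  exact one_smul _ _

theorem isAtom_codeZero (hG : Odd (Nat.card G)) : IsAtom (codeZero G) := by
  refine ⟨?_, fun J hJ => ?_⟩
  · rw [Ne, codeZero, Ideal.span_singleton_eq_bot]
    exact subgroupHat_ne_zero hG _
  · by_contra hbot
    refine hJ.not_ge ?_
    obtain ⟨y, hy, hy0⟩ := Submodule.exists_mem_ne_zero_of_ne_bot hbot
    rw [eq_subgroupHat_top_of_mem_codeZero (hJ.le hy) hy0] at hy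
    exact (Ideal.span_singleton_le_iff_mem _).2 hy

theorem finrank_codeZero (hG : Odd (Nat.card G)) :
    Module.finrank (ZMod 2) (codeZero G) = 1 := by
  refine finrank_eq_one ⟨_, subgroupHat_top_mem_codeZero⟩ ?_ ?_
  · exact fun h => subgroupHat_ne_zero hG _ (congrArg Subtype.val h)
  · rintro ⟨w, hw⟩
    obtain ⟨c, hc⟩ := mem_codeZero_iff.1 hw
    exact ⟨c, Subtype.ext hc⟩

theorem hasCodeWeight_codeZero (hG : Odd (Nat.card G)) :
    HasCodeWeight (codeZero G) (Nat.card G) := by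
  have hw := hammingWeight_subgroupHat hG (⊤ : Subgroup G)
  rw [Subgroup.card_top] at hw
  refine ⟨⟨_, subgroupHat_top_mem_codeZero, subgroupHat_ne_zero hG _, hw⟩, ?_⟩
  rintro m ⟨y, hy, hy0, rfl⟩
  rw [eq_subgroupHat_top_of_mem_codeZero hy hy0, hw]

end CodeZero

/-! ### Every minimal code is on the list. -/

section MinimalIdeal

variable {R : Type*} [CommRing R] {I : Ideal R}

/-- The elements of I killed by x form a subideal, which is nonzero and so all of I. -/
theorem mul_eq_zero_of_isAtom (hI : IsAtom I) {x y : R} (hy : y ∈ I) (hy0 : y ≠ 0)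
    (hxy : x * y = 0) : ∀ z ∈ I, x * z = 0 := by
  let J : Ideal R := I ⊓ LinearMap.ker (LinearMap.mulLeft R x)
  have hJ : J = I := (hI.le_iff.1 inf_le_left).resolve_left fun h =>
    hy0 ((Submodule.mem_bot R).1 (h ▸ (⟨hy, hxy⟩ : y ∈ J)))
  intro z hz
  rw [← hJ] at hz
  exact hz.2

theorem isPrime_annihilator_of_isAtom (hI : IsAtom I) : (Submodule.annihilator I).IsPrime := by
  refine Ideal.isPrime_iff.2 ⟨?_, fun {x y} hxy => ?_⟩
  · rw [Ne, Submodule.annihilator_eq_top_iff]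
    exact hI.1
  · rw [or_iff_not_imp_right]
    intro hy
    simp only [Submodule.mem_annihilator, smul_eq_mul] at hxy hy ⊢
    push Not at hy
    obtain ⟨z, hz, hyz⟩ := hy
    exact mul_eq_zero_of_isAtom hI (I.mul_mem_left y hz) hyz (by rw [← mul_assoc, hxy z hz])

end MinimalIdeal

section MinimalCode

variable {G : Type*} [CommGroup G] {I : GroupCode (ZMod 2) G}

theorem mem_fixingGroup_iff_sub_one_mem_annihilator {g : G} :
    g ∈ fixingGroup (I : Set (MonoidAlgebra (ZMod 2) G)) ↔
      MonoidAlgebra.of (ZMod 2) G g - 1 ∈ Submodule.annihilator I := by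
  simp only [mem_fixingGroup, Submodule.mem_annihilator, SetLike.mem_coe, smul_eq_mul, sub_mul,
    one_mul, sub_eq_zero]

/-- Modulo the annihilator, a domain, b becomes a primitive p-th root of unity and `c⁻¹` a p-th root
of unity, hence a power of b. -/
theorem exists_mul_pow_mem_fixingGroup {p : ℕ} (hp : p.Prime) (hI : IsAtom I) {b c : G}
    (hb : b ∉ fixingGroup (I : Set (MonoidAlgebra (ZMod 2) G))) (hbp : b ^ p = 1)
    (hc : c ^ p ∈ fixingGroup (I : Set (MonoidAlgebra (ZMod 2) G))) :
    ∃ i < p, c * b ^ i ∈ fixingGroup (I : Set (MonoidAlgebra (ZMod 2) G)) := by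
  have := isPrime_annihilator_of_isAtom hI
  have := Fact.mk hp
  let q : G →* MonoidAlgebra (ZMod 2) G ⧸ Submodule.annihilator I :=
    (Ideal.Quotient.mk (Submodule.annihilator I)).toMonoidHom.comp (MonoidAlgebra.of (ZMod 2) G)
  have hq (g : G) : g ∈ fixingGroup (I : Set (MonoidAlgebra (ZMod 2) G)) ↔ q g = 1 := by
    rw [mem_fixingGroup_iff_sub_one_mem_annihilator, ← Ideal.Quotient.eq_zero_iff_mem, map_sub,
      sub_eq_zero, map_one]
    rfl
  have hprim : IsPrimitiveRoot (q b) p := by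
    rw [IsPrimitiveRoot.iff_orderOf]
    refine orderOf_eq_prime ?_ fun h => hb ((hq b).2 h)
    rw [← map_pow, hbp, map_one]
  have hcp : q c⁻¹ ^ p = 1 := by
    rw [← map_pow, inv_pow]
    exact (hq _).1 (inv_mem hc)
  obtain ⟨i, hi, h⟩ := hprim.eq_pow_of_pow_eq_one hcp
  refine ⟨i, hi, (hq _).2 ?_⟩
  rw [map_mul, map_pow, h, ← map_mul, mul_inv_cancel, map_one]

variable [Finite G]

/-- The product (g - 1)K̂ is 0, and g - 1 lies outside the prime annihilator. -/
theorem subgroupHat_mul_eq_zero_of_notMem_fixingGroup (hI : IsAtom I) {K : Subgroup G} {g : G}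
    (hgK : g ∈ K) (hg : g ∉ fixingGroup (I : Set (MonoidAlgebra (ZMod 2) G)))
    {y : MonoidAlgebra (ZMod 2) G} (hy : y ∈ I) : subgroupHat (ZMod 2) K * y = 0 := by
  have hmul : (MonoidAlgebra.of (ZMod 2) G g - 1) * subgroupHat (ZMod 2) K ∈
      Submodule.annihilator I := by
    rw [sub_mul, one_mul, of_mul_subgroupHat hgK, sub_self]
    exact zero_mem _
  rw [mem_fixingGroup_iff_sub_one_mem_annihilator] at hg
  exact Submodule.mem_annihilator.1
    (((isPrime_annihilator_of_isAtom hI).mem_or_mem hmul).resolve_left hg) y hy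

/-- On I, Ĥ acts as 1 and K̂ as 0, so I lies in the minimal ideal (Ĥ - K̂). -/
theorem eq_span_of_le_fixingGroup (hG : Odd (Nat.card G)) (hI : IsAtom I) {H K : Subgroup G}
    (hatom : IsAtom (Ideal.span {subgroupHat (ZMod 2) H - subgroupHat (ZMod 2) K}))
    (hH : H ≤ fixingGroup (I : Set (MonoidAlgebra (ZMod 2) G))) {g : G} (hgK : g ∈ K)
    (hg : g ∉ fixingGroup (I : Set (MonoidAlgebra (ZMod 2) G))) :
    I = Ideal.span {subgroupHat (ZMod 2) H - subgroupHat (ZMod 2) K} := by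
  refine (hatom.le_iff.1 fun y hy => Ideal.mem_span_singleton'.2 ⟨y, ?_⟩).resolve_left hI.1
  rw [mul_comm, sub_mul, subgroupHat_mul_of_fixed hG fun h hh => hH hh y hy,
    subgroupHat_mul_eq_zero_of_notMem_fixingGroup hI hgK hg hy, sub_zero]

theorem eq_codeZero_of_fixingGroup_eq_top (hG : Odd (Nat.card G)) (hI : IsAtom I)
    (h : fixingGroup (I : Set (MonoidAlgebra (ZMod 2) G)) = ⊤) : I = codeZero G := by
  refine ((isAtom_codeZero hG).le_iff.1 fun y hy =>
    Ideal.mem_span_singleton'.2 ⟨y, ?_⟩).resolve_left hI.1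
  rw [mul_comm, subgroupHat_mul_of_fixed hG fun g _ => (h ▸ Subgroup.mem_top g :
    g ∈ fixingGroup (I : Set (MonoidAlgebra (ZMod 2) G))) y hy]

theorem eq_of_isMinimalCode {n p : ℕ} (hp : p.Prime) (hodd : Odd p) (hG : Odd (Nat.card G))
    (hirr : ∀ k, Irreducible (Polynomial.cyclotomic (p ^ (k + 1)) (ZMod 2)))
    {a b : G} (ha : orderOf a = p ^ n) (hb : orderOf b = p)
    (hab : IsCompl (Subgroup.zpowers a) (Subgroup.zpowers b)) (hI : IsAtom I) :
    I = codeZero G ∨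
      (∃ k < n, I = codeK p a b (k + 1)) ∨
      I = codeKI p a b 1 0 ∨
      (∃ k i, k < n ∧ 1 ≤ i ∧ i < p ∧ I = codeKI p a b (k + 1) i) := by
  classical
  set N := fixingGroup (I : Set (MonoidAlgebra (ZMod 2) G)) with hN
  by_cases haN : a ∈ N
  · by_cases hbN : b ∈ N
    · left
      apply eq_codeZero_of_fixingGroup_eq_top hG hI
      rw [eq_top_iff, ← hab.sup_eq_top, sup_le_iff, Subgroup.zpowers_le, Subgroup.zpowers_le]
      exact ⟨haN, hbN⟩
    · right; right; left
      have h := isCocyclicPair_codeKI_zero hp hb hab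
      have := eq_span_of_le_fixingGroup hG hI (h.isAtom hG hp hodd (hirr 0))
        (Subgroup.zpowers_le.2 haN) (Subgroup.mem_sup_right (Subgroup.mem_zpowers b)) hbN
      simpa [codeKI] using this
  · have hex : ∃ k, a ^ p ^ (k + 1) ∈ N := ⟨n, by
      rw [pow_succ, pow_mul, ← ha, pow_orderOf_eq_one, one_pow]
      exact one_mem _⟩
    -- With k least, `a ^ p ^ k` is outside N; for k = 0 this is a ∉ N itself. It lies in K and
    -- shows K ≰ N.
    let k := Nat.find hex
    have hk : a ^ p ^ (k + 1) ∈ N := Nat.find_spec hex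
    have hk' : a ^ p ^ k ∉ N := by
      rcases hk0 : k with _ | m
      · simpa using haN
      · exact Nat.find_min hex (show m < k by omega)
    have hkn : k < n := by
      by_contra hle
      apply hk'
      obtain ⟨d, hd⟩ := Nat.exists_eq_add_of_le (not_lt.1 hle)
      rw [hd, pow_add, pow_mul, ← ha, pow_orderOf_eq_one, one_pow]
      exact one_mem _
    by_cases hbN : b ∈ N
    · right; left
      refine ⟨k, hkn, ?_⟩
      have h := isCocyclicPair_codeK hp ha hab hkn
      exact eq_span_of_le_fixingGroup hG hI (h.isAtom hG hp hodd (hirr k))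
        (sup_le (Subgroup.zpowers_le.2 hk) (Subgroup.zpowers_le.2 hbN)) h.pow_mem_right hk'
    · right; right; right
      obtain ⟨i, hip, hi⟩ := exists_mul_pow_mem_fixingGroup (c := a ^ p ^ k) hp hI hbN
        (by rw [← hb, pow_orderOf_eq_one]) (by rwa [← pow_mul, ← pow_succ])
      have hi1 : 1 ≤ i := by
        rw [Nat.one_le_iff_ne_zero]
        rintro rfl
        exact hk' (by simpa using hi)
      refine ⟨k, i, hkn, hi1, hip, ?_⟩
      have h := isCocyclicPair_codeKI hp ha hb hab hkn
        (Nat.coprime_of_lt_prime (by omega) hip hp)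
      exact eq_span_of_le_fixingGroup hG hI (h.isAtom hG hp hodd (hirr k))
        (Subgroup.zpowers_le.2 hi) h.pow_mem_right hk'

end MinimalCode

/-! ### Automorphisms of G and their action on codes. -/

section Automorphisms

variable {G : Type*} [CommGroup G] {a b : G}

/-- Coordinates are unique modulo the orders of a and b, which also kill a' and b', so any choice of
coordinates gives a homomorphism. Surjectivity and finiteness make it bijective. -/
theorem exists_mulEquiv_of_isCompl_zpowers [Finite G]
    (hab : IsCompl (Subgroup.zpowers a) (Subgroup.zpowers b)) {a' b' : G}
    (ha' : a' ^ orderOf a = 1) (hb' : b' ^ orderOf b = 1)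
    (htop : Subgroup.zpowers a' ⊔ Subgroup.zpowers b' = ⊤) :
    ∃ ψ : G ≃* G, ψ a = a' ∧ ψ b = b' := by
  choose i j hij using exists_zpow_mul_zpow_eq hab
  let f : G → G := fun g => a' ^ i g * b' ^ j g
  have hf (r s : ℤ) : f (a ^ r * b ^ s) = a' ^ r * b' ^ s := by
    obtain ⟨h1, h2⟩ := (zpow_mul_zpow_eq_iff hab _ _ _ _).1 (hij (a ^ r * b ^ s))
    have h1 := (orderOf_dvd_iff_zpow_eq_one (x := a')).1
      ((Int.natCast_dvd_natCast.2 (orderOf_dvd_of_pow_eq_one ha')).trans h1)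
    have h2 := (orderOf_dvd_iff_zpow_eq_one (x := b')).1
      ((Int.natCast_dvd_natCast.2 (orderOf_dvd_of_pow_eq_one hb')).trans h2)
    rw [zpow_sub, mul_inv_eq_one] at h1 h2
    simp only [f]
    rw [h1, h2]
  let φ : G →* G := MonoidHom.mk' f fun g h => by
    rw [← hij g, ← hij h, mul_mul_mul_comm, ← zpow_add, ← zpow_add, hf, hf, hf, zpow_add, zpow_add,
      mul_mul_mul_comm]
  have hsurj : Function.Surjective φ := by
    intro g
    obtain ⟨r, s, rfl⟩ := mem_zpowers_sup_zpowers.1 (htop ▸ Subgroup.mem_top g)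
    exact ⟨a ^ r * b ^ s, hf r s⟩
  refine ⟨MulEquiv.ofBijective φ (Finite.surjective_iff_bijective.1 hsurj), ?_, ?_⟩
  · simpa using! hf 1 0
  · simpa using! hf 0 1

theorem zpowers_mul_sup_zpowers (x y : G) :
    Subgroup.zpowers (x * y) ⊔ Subgroup.zpowers y = Subgroup.zpowers x ⊔ Subgroup.zpowers y := by
  apply le_antisymm
  · refine sup_le ?_ le_sup_right
    rw [Subgroup.zpowers_le]
    exact Subgroup.mul_mem_sup (Subgroup.mem_zpowers x) (Subgroup.mem_zpowers y)
  · refine sup_le ?_ le_sup_right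
    rw [Subgroup.zpowers_le, ← Subgroup.mul_mem_cancel_right _ (x := y)]
    · exact Subgroup.mem_sup_left (Subgroup.mem_zpowers _)
    · exact Subgroup.mem_sup_right (Subgroup.mem_zpowers _)

theorem zpowers_sup_zpowers_mul (x y : G) :
    Subgroup.zpowers x ⊔ Subgroup.zpowers (x * y) = Subgroup.zpowers x ⊔ Subgroup.zpowers y := by
  rw [sup_comm, mul_comm, zpowers_mul_sup_zpowers, sup_comm]

end Automorphisms

section GEquivalence

variable {G : Type*} [CommGroup G]

theorem domCongr_subgroupHat [Finite G] (hG : Odd (Nat.card G)) (ψ : G ≃* G) (H : Subgroup G) :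
    MonoidAlgebra.domCongr (ZMod 2) (ZMod 2) ψ (subgroupHat (ZMod 2) H) =
      subgroupHat (ZMod 2) (H.map ψ.toMonoidHom) := by
  classical
  ext g
  rw [MonoidAlgebra.coeff_domCongr, coeff_subgroupHat hG, coeff_subgroupHat hG,
    Subgroup.mem_map_equiv]

theorem gEquivalent_span [Finite G] (hG : Odd (Nat.card G)) (ψ : G ≃* G) {H K H' K' : Subgroup G}
    (hH : H.map ψ.toMonoidHom = H') (hK : K.map ψ.toMonoidHom = K') :
    GEquivalent (Ideal.span {subgroupHat (ZMod 2) H - subgroupHat (ZMod 2) K})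
      (Ideal.span {subgroupHat (ZMod 2) H' - subgroupHat (ZMod 2) K'}) := by
  refine ⟨ψ, ?_⟩
  rw [← hH, ← hK, ← domCongr_subgroupHat hG, ← domCongr_subgroupHat hG, ← map_sub]
  ext y
  simp only [Set.mem_image, SetLike.mem_coe, Ideal.mem_span_singleton']
  constructor
  · rintro ⟨_, ⟨z, rfl⟩, rfl⟩
    exact ⟨_, (map_mul _ _ _).symm⟩
  · rintro ⟨z, rfl⟩
    obtain ⟨z, rfl⟩ := (MonoidAlgebra.domCongr (ZMod 2) (ZMod 2) ψ).surjective z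
    exact ⟨_, ⟨z, rfl⟩, map_mul _ _ _⟩

theorem GEquivalent.finrank_eq {F : Type*} [Field F] {I J : GroupCode F G}
    (h : GEquivalent I J) : Module.finrank F I = Module.finrank F J := by
  obtain ⟨ψ, h⟩ := h
  have hmap : (I.restrictScalars F).map
      (MonoidAlgebra.domCongr F F ψ).toLinearEquiv.toLinearMap = J.restrictScalars F :=
    SetLike.coe_injective h
  have := LinearEquiv.finrank_map_eq (MonoidAlgebra.domCongr F F ψ).toLinearEquiv
    (I.restrictScalars F)
  exact this.symm.trans (by rw [hmap]; rfl)

theorem map_mem_fixingGroup {F : Type*} [Field F] {I J : GroupCode F G} {ψ : G ≃* G}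
    (h : MonoidAlgebra.domCongr F F ψ '' (I : Set (MonoidAlgebra F G)) = J) {g : G}
    (hg : g ∈ fixingGroup (I : Set (MonoidAlgebra F G))) :
    ψ g ∈ fixingGroup (J : Set (MonoidAlgebra F G)) := by
  rw [mem_fixingGroup, ← h]
  rintro _ ⟨y, hy, rfl⟩
  conv_rhs => rw [← hg y hy, map_mul]
  simp

end GEquivalence

/-! ### Equivalences and inequivalences between the listed codes. -/

section Classes

variable {G : Type*} [CommGroup G] [Finite G] {n p : ℕ} {a b : G}

theorem gEquivalent_codeKI_one (hG : Odd (Nat.card G)) (hb : orderOf b = p)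
    (hab : IsCompl (Subgroup.zpowers a) (Subgroup.zpowers b)) (k : ℕ) {i : ℕ}
    (hi : p.Coprime i) : GEquivalent (codeKI p a b (k + 1) 1) (codeKI p a b (k + 1) i) := by
  have hz := zpowers_pow_eq_of_coprime (b := b) (hb.symm ▸ hi)
  obtain ⟨ψ, hψa, hψb⟩ := exists_mulEquiv_of_isCompl_zpowers hab (a' := a) (b' := b ^ i)
    (pow_orderOf_eq_one a) (by rw [← pow_mul, mul_comm, pow_mul, pow_orderOf_eq_one, one_pow])
    (by rw [hz, hab.sup_eq_top])
  refine gEquivalent_span hG ψ ?_ ?_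
  · simp [MonoidHom.map_zpowers, hψa, hψb]
  · simp [Subgroup.map_sup, MonoidHom.map_zpowers, hψa, hψb, hz]

theorem gEquivalent_codeKI_one_zero (hG : Odd (Nat.card G))
    (hba : orderOf b ∣ orderOf a) (hab : IsCompl (Subgroup.zpowers a) (Subgroup.zpowers b)) :
    GEquivalent (codeKI p a b 1 0) (codeKI p a b 1 1) := by
  obtain ⟨ψ, hψa, hψb⟩ := exists_mulEquiv_of_isCompl_zpowers hab (a' := a * b) (b' := b)
    (by rw [mul_pow, pow_orderOf_eq_one, one_mul, orderOf_dvd_iff_pow_eq_one.1 hba])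
    (pow_orderOf_eq_one b) (by rw [zpowers_mul_sup_zpowers, hab.sup_eq_top])
  refine gEquivalent_span hG ψ ?_ ?_
  · simp [MonoidHom.map_zpowers, hψa]
  · simp [Subgroup.map_sup, MonoidHom.map_zpowers, hψa, hψb, zpowers_mul_sup_zpowers]

/-- At the top level `a ^ p ^ (k + 1) = 1`, so H is just ⟨b⟩, and b ↦ `a ^ p ^ k * b` carries it to
the other cyclic subgroup. -/
theorem gEquivalent_codeK_codeKI (hG : Odd (Nat.card G)) {k : ℕ} (ha : orderOf a = p ^ (k + 1))
    (hb : orderOf b = p) (hab : IsCompl (Subgroup.zpowers a) (Subgroup.zpowers b)) :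
    GEquivalent (codeK p a b (k + 1)) (codeKI p a b (k + 1) 1) := by
  have ha1 : a ^ p ^ (k + 1) = 1 := by rw [← ha, pow_orderOf_eq_one]
  obtain ⟨ψ, hψa, hψb⟩ := exists_mulEquiv_of_isCompl_zpowers hab (a' := a) (b' := a ^ p ^ k * b)
    (pow_orderOf_eq_one a)
    (by rw [mul_pow, pow_orderOf_eq_one, mul_one, hb, ← pow_mul, ← pow_succ, ha1]) (by
      rw [eq_top_iff, ← hab.sup_eq_top]
      refine sup_le le_sup_left ?_
      rw [Subgroup.zpowers_le, ← Subgroup.mul_mem_cancel_left _ (x := a ^ p ^ k)]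
      · exact Subgroup.mem_sup_right (Subgroup.mem_zpowers _)
      · exact Subgroup.mem_sup_left (Subgroup.pow_mem _ (Subgroup.mem_zpowers _) _))
  refine gEquivalent_span hG ψ ?_ ?_
  · simp [MonoidHom.map_zpowers, hψb, ha1]
  · simp [Subgroup.map_sup, MonoidHom.map_zpowers, hψa, hψb, zpowers_sup_zpowers_mul]

/-- An equivalence would carry `a ^ p ^ k * b` into ⟨`a ^ p ^ (k + 1)`⟩⟨b⟩, which is killed by `p ^
(n - k - 1)`; the element is not. -/
theorem not_gEquivalent_codeKI_codeK (hp : p.Prime) (hG : Odd (Nat.card G))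
    (ha : orderOf a = p ^ n) (hb : orderOf b = p)
    (hab : IsCompl (Subgroup.zpowers a) (Subgroup.zpowers b)) {k : ℕ} (hk : k + 1 < n) :
    ¬ GEquivalent (codeKI p a b (k + 1) 1) (codeK p a b (k + 1)) := by
  rintro ⟨ψ, h⟩
  obtain ⟨d, rfl⟩ := Nat.exists_eq_add_of_lt hk
  have hH := (isCocyclicPair_codeKI hp ha hb hab (k := k) (by omega)
    (Nat.coprime_one_right p)).fixingGroup_span hG
  have hH' := (isCocyclicPair_codeK hp ha hab (k := k) (by omega)).fixingGroup_span hG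
  have hg : a ^ p ^ k * b ^ 1 ∈ fixingGroup
      (codeKI p a b (k + 1) 1 : Set (MonoidAlgebra (ZMod 2) G)) := by
    simp only [codeKI, Nat.add_sub_cancel, hH]
    exact Subgroup.mem_zpowers _
  rw [pow_one] at hg
  have hψg := map_mem_fixingGroup h hg
  simp only [codeK, Nat.add_sub_cancel, hH'] at hψg
  obtain ⟨r, s, hrs⟩ := mem_zpowers_sup_zpowers.1 hψg
  have hpow : (a ^ p ^ k * b) ^ p ^ (d + 1) = 1 := by
    apply ψ.injective
    have hcomm (x : G) (r : ℤ) (N : ℕ) : (x ^ r) ^ N = (x ^ N) ^ r := by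
      simp only [← zpow_natCast]
      exact zpow_comm _ _ _
    have ha1 : (a ^ p ^ (k + 1)) ^ p ^ (d + 1) = 1 := by
      rw [← pow_mul, ← pow_add, ← add_assoc, ← ha, pow_orderOf_eq_one]
    have hb1 : b ^ p ^ (d + 1) = 1 := by
      rw [pow_succ', pow_mul, ← hb, pow_orderOf_eq_one, one_pow]
    rw [map_pow, ← hrs, map_one, mul_pow, hcomm, hcomm, ha1, hb1, one_zpow, one_zpow, one_mul]
  have hpow' : a ^ ((p : ℤ) ^ (k + d + 1)) * b ^ ((p : ℤ) ^ (d + 1)) = 1 := by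
    rw [mul_pow, ← pow_mul, ← pow_add, ← add_assoc] at hpow
    exact_mod_cast hpow
  rw [zpow_mul_zpow_eq_one_iff hab, ha] at hpow'
  have := Nat.le_of_dvd (pow_pos hp.pos _) (by exact_mod_cast hpow'.1 : _ ∣ p ^ (k + d + 1))
  exact absurd ((Nat.pow_le_pow_iff_right hp.one_lt).1 this) (by omega)

end Classes

/-! ### Counting the equivalence classes. -/

section Count

variable {G : Type*} [CommGroup G] {n p : ℕ} {a b : G}

/-- Representatives of the `G`-equivalence classes of minimal codes. -/
noncomputable def codeRepresentative (p n : ℕ) (a b : G) :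
    Option (Fin n ⊕ Fin (n - 1)) → GroupCode (ZMod 2) G
  | none => codeZero G
  | some (.inl k) => codeK p a b (k + 1)
  | some (.inr k) => codeKI p a b (k + 1) 1

theorem exponent_of_isCompl_zpowers (hba : orderOf b ∣ orderOf a)
    (hab : IsCompl (Subgroup.zpowers a) (Subgroup.zpowers b)) :
    Monoid.exponent G = orderOf a := by
  refine Nat.dvd_antisymm (Monoid.exponent_dvd_of_forall_pow_eq_one fun g => ?_)
    (Monoid.order_dvd_exponent a)
  obtain ⟨i, j, rfl⟩ := exists_zpow_mul_zpow_eq hab g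
  have hcomm (x : G) (r : ℤ) (N : ℕ) : (x ^ r) ^ N = (x ^ N) ^ r := by
    simp only [← zpow_natCast]
    exact zpow_comm _ _ _
  rw [mul_pow, hcomm, hcomm, pow_orderOf_eq_one, orderOf_dvd_iff_pow_eq_one.1 hba, one_zpow,
    one_zpow, one_mul]

variable [Finite G]

theorem isMinimalCode_iff (hp : p.Prime) (hodd : Odd p) (hG : Odd (Nat.card G))
    (hirr : ∀ k, Irreducible (Polynomial.cyclotomic (p ^ (k + 1)) (ZMod 2)))
    (ha : orderOf a = p ^ n) (hb : orderOf b = p)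
    (hab : IsCompl (Subgroup.zpowers a) (Subgroup.zpowers b)) (I : GroupCode (ZMod 2) G) :
    IsMinimalCode I ↔ I = codeZero G ∨
      (∃ k < n, I = codeK p a b (k + 1)) ∨
      I = codeKI p a b 1 0 ∨
      (∃ k i, k < n ∧ 1 ≤ i ∧ i < p ∧ I = codeKI p a b (k + 1) i) := by
  refine ⟨eq_of_isMinimalCode hp hodd hG hirr ha hb hab, ?_⟩
  rintro (rfl | ⟨k, hk, rfl⟩ | rfl | ⟨k, i, hk, hi1, hip, rfl⟩)
  · exact isAtom_codeZero hG
  · exact (isCocyclicPair_codeK hp ha hab hk).isAtom hG hp hodd (hirr k)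
  · have := (isCocyclicPair_codeKI_zero hp hb hab).isAtom hG hp hodd (hirr 0)
    simpa [codeKI, IsMinimalCode] using this
  · exact (isCocyclicPair_codeKI hp ha hb hab hk
      (Nat.coprime_of_lt_prime (by omega) hip hp)).isAtom hG hp hodd (hirr k)

theorem isMinimalCode_codeRepresentative (hp : p.Prime) (hodd : Odd p) (hG : Odd (Nat.card G))
    (hirr : ∀ k, Irreducible (Polynomial.cyclotomic (p ^ (k + 1)) (ZMod 2)))
    (ha : orderOf a = p ^ n) (hb : orderOf b = p)
    (hab : IsCompl (Subgroup.zpowers a) (Subgroup.zpowers b)) (r : Option (Fin n ⊕ Fin (n - 1))) :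
    IsMinimalCode (codeRepresentative p n a b r) := by
  rw [isMinimalCode_iff hp hodd hG hirr ha hb hab]
  rcases r with _ | k | k
  · exact Or.inl rfl
  · exact Or.inr (Or.inl ⟨k, k.2, rfl⟩)
  · exact Or.inr (Or.inr (Or.inr ⟨k, 1, by omega, le_rfl, hp.one_lt, rfl⟩))

theorem exists_gEquivalent_codeRepresentative (hp : p.Prime) (hodd : Odd p)
    (hG : Odd (Nat.card G))
    (hirr : ∀ k, Irreducible (Polynomial.cyclotomic (p ^ (k + 1)) (ZMod 2))) (hn : 2 ≤ n)
    (ha : orderOf a = p ^ n) (hb : orderOf b = p)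
    (hab : IsCompl (Subgroup.zpowers a) (Subgroup.zpowers b)) {I : GroupCode (ZMod 2) G}
    (hI : IsMinimalCode I) : ∃ r, GEquivalent (codeRepresentative p n a b r) I := by
  have heq := GEquivalent.equivalence (ZMod 2) G
  rcases (isMinimalCode_iff hp hodd hG hirr ha hb hab I).1 hI with
    (rfl | ⟨k, hk, rfl⟩ | rfl | ⟨k, i, hk, hi1, hip, rfl⟩)
  · exact ⟨none, heq.refl _⟩
  · exact ⟨some (.inl ⟨k, hk⟩), heq.refl _⟩
  · refine ⟨some (.inr ⟨0, by omega⟩), heq.symm (gEquivalent_codeKI_one_zero hG ?_ hab)⟩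
    rw [ha, hb]
    exact dvd_pow_self p (by omega)
  · have h := gEquivalent_codeKI_one hG hb hab k (Nat.coprime_of_lt_prime (by omega) hip hp)
    by_cases hkn : k < n - 1
    · exact ⟨some (.inr ⟨k, hkn⟩), h⟩
    -- At level n the second family joins the first, hence the index type `Fin (n - 1)` for it.
    · obtain rfl : n = k + 1 := by omega
      exact ⟨some (.inl ⟨k, hk⟩), heq.trans (gEquivalent_codeK_codeKI hG ha hb hab) h⟩

/-- Equal dimensions force equal levels; dimension 1 is isolated since p - 1 ≥ 2. -/
theorem codeRepresentative_injective (hp : p.Prime) (hodd : Odd p) (hG : Odd (Nat.card G))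
    (hirr : ∀ k, Irreducible (Polynomial.cyclotomic (p ^ (k + 1)) (ZMod 2)))
    (ha : orderOf a = p ^ n) (hb : orderOf b = p)
    (hab : IsCompl (Subgroup.zpowers a) (Subgroup.zpowers b)) {r s : Option (Fin n ⊕ Fin (n - 1))}
    (h : GEquivalent (codeRepresentative p n a b r) (codeRepresentative p n a b s)) : r = s := by
  have heq := GEquivalent.equivalence (ZMod 2) G
  have hp3 : 2 ≤ p - 1 := by
    have := hp.two_le
    rcases hodd with ⟨c, rfl⟩
    omega
  have h1 (k : ℕ) : p ^ k * (p - 1) ≠ 1 := by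
    intro hk
    have := Nat.eq_one_of_mul_eq_one_left hk
    omega
  have hinj (k l : ℕ) (hkl : p ^ k * (p - 1) = p ^ l * (p - 1)) : k = l :=
    Nat.pow_right_injective hp.two_le (Nat.eq_of_mul_eq_mul_right (by omega) hkl)
  have hK (k : Fin n) : Module.finrank (ZMod 2) (codeK p a b (k + 1)) = p ^ (k : ℕ) * (p - 1) :=
    (isCocyclicPair_codeK hp ha hab k.2).finrank_span hG hp hodd (hirr k)
  have hKI (k : Fin (n - 1)) :
      Module.finrank (ZMod 2) (codeKI p a b (k + 1) 1) = p ^ (k : ℕ) * (p - 1) :=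
    (isCocyclicPair_codeKI hp ha hb hab (by omega) (Nat.coprime_one_right p)).finrank_span
      hG hp hodd (hirr k)
  let d : Option (Fin n ⊕ Fin (n - 1)) → ℕ
    | none => 1
    | some (.inl k) => p ^ (k : ℕ) * (p - 1)
    | some (.inr k) => p ^ (k : ℕ) * (p - 1)
  have hd : ∀ r, Module.finrank (ZMod 2) (codeRepresentative p n a b r) = d r
    | none => finrank_codeZero hG
    | some (.inl k) => hK k
    | some (.inr k) => hKI k
  have hdim : d r = d s := by rw [← hd, ← hd, h.finrank_eq]
  rcases r with _ | k | k <;> rcases s with _ | l | l <;>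
    simp only [codeRepresentative, d] at hdim h
  · rfl
  · exact absurd hdim.symm (h1 _)
  · exact absurd hdim.symm (h1 _)
  · exact absurd hdim (h1 _)
  · rw [Fin.ext (hinj _ _ hdim)]
  · rw [hinj _ _ hdim] at h
    exact absurd (heq.symm h) (not_gEquivalent_codeKI_codeK hp hG ha hb hab (by omega))
  · exact absurd hdim (h1 _)
  · rw [← hinj _ _ hdim] at h
    exact absurd h (not_gEquivalent_codeKI_codeK hp hG ha hb hab (by omega))
  · rw [Fin.ext (hinj _ _ hdim)]

theorem numMinimalCodeClasses_eq (hp : p.Prime) (hodd : Odd p) (hG : Odd (Nat.card G))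
    (hirr : ∀ k, Irreducible (Polynomial.cyclotomic (p ^ (k + 1)) (ZMod 2))) (hn : 2 ≤ n)
    (ha : orderOf a = p ^ n) (hb : orderOf b = p)
    (hab : IsCompl (Subgroup.zpowers a) (Subgroup.zpowers b)) :
    numMinimalCodeClasses (ZMod 2) G = 2 * n := by
  let f : Option (Fin n ⊕ Fin (n - 1)) → Quotient (minimalCodeSetoid (ZMod 2) G) := fun r =>
    Quotient.mk _ ⟨codeRepresentative p n a b r,
      isMinimalCode_codeRepresentative hp hodd hG hirr ha hb hab r⟩
  have hf : Function.Bijective f := by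
    refine ⟨fun r s hrs => codeRepresentative_injective hp hodd hG hirr ha hb hab
      (Quotient.exact hrs), fun q => ?_⟩
    induction q using Quotient.inductionOn with
    | h I =>
      obtain ⟨r, hr⟩ := exists_gEquivalent_codeRepresentative hp hodd hG hirr hn ha hb hab I.2
      exact ⟨r, Quotient.sound hr⟩
  rw [numMinimalCodeClasses, ← Nat.card_congr (Equiv.ofBijective f hf), Nat.card_eq_fintype_card]
  simp
  omega

end Count

/-! ### Assembly of the main theorem. -/

theorem IsCocyclicPair.card_eq {G : Type*} [CommGroup G] {p n k : ℕ} {H K : Subgroup G}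
    {x : G} (h : IsCocyclicPair p k H K x) (hp : p.Prime) (hG : Nat.card G = p ^ (n + 1))
    (hk : k < n) : Nat.card H = p ^ (n - k) := by
  have := H.card_mul_index
  rw [h.index_eq hp, hG, show n + 1 = (n - k) + (k + 1) by omega, pow_add p (n - k)] at this
  exact Nat.eq_of_mul_eq_mul_right (pow_pos hp.pos _) this

theorem mainTheorem8 {G : Type*} [CommGroup G] (n p : ℕ) (hn : 3 ≤ n)
    (hp : p.Prime) (hodd : Odd p)
    -- the class of `2` generates the group of units of `ℤ/p²`
    (u : (ZMod (p ^ 2))ˣ) (hu : (u : ZMod (p ^ 2)) = 2) (hgen : Subgroup.zpowers u = ⊤)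
    -- `G` is the internal direct product of `⟨a⟩` and `⟨b⟩`
    (a b : G) (ha : orderOf a = p ^ n) (hb : orderOf b = p)
    (hab : IsCompl (Subgroup.zpowers a) (Subgroup.zpowers b)) :
    -- the minimal codes
    (∀ I : GroupCode (ZMod 2) G, IsMinimalCode I ↔
      I = codeZero G ∨
      (∃ k, 1 ≤ k ∧ k ≤ n ∧ I = codeK p a b k) ∨
      (∃ i, i < p ∧ I = codeKI p a b 1 i) ∨
      (∃ k i, 2 ≤ k ∧ k ≤ n ∧ 1 ≤ i ∧ i < p ∧ I = codeKI p a b k i)) ∧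
    -- their dimensions and weights
    (Module.finrank (ZMod 2) (codeZero G) = 1 ∧ HasCodeWeight (codeZero G) (p ^ (n + 1))) ∧
    (∀ k, 1 ≤ k → k ≤ n →
      Module.finrank (ZMod 2) (codeK p a b k) = p ^ (k - 1) * (p - 1) ∧
      HasCodeWeight (codeK p a b k) (2 * p ^ (n - k + 1))) ∧
    (∀ i, i < p →
      Module.finrank (ZMod 2) (codeKI p a b 1 i) = p - 1 ∧
      HasCodeWeight (codeKI p a b 1 i) (2 * p ^ n)) ∧
    (∀ k i, 2 ≤ k → k ≤ n → 1 ≤ i → i < p →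
      Module.finrank (ZMod 2) (codeKI p a b k i) = p ^ (k - 1) * (p - 1) ∧
      HasCodeWeight (codeKI p a b k i) (2 * p ^ (n - k + 1))) ∧
    -- the number of `G`-equivalence classes
    numMinimalCodeClasses (ZMod 2) G = 2 * n ∧
    -- `G` has odd order, but this number is not the number of divisors of its exponent
    Finite G ∧ Odd (Nat.card G) ∧
    numMinimalCodeClasses (ZMod 2) G ≠ (Monoid.exponent G).divisors.card := by
  have hcard : Nat.card G = p ^ (n + 1) := by
    rw [card_of_isCompl_zpowers hab, ha, hb, pow_succ]
  have hfin : Finite G := Nat.finite_of_card_ne_zero (hcard ▸ pow_ne_zero _ hp.ne_zero)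
  have hG : Odd (Nat.card G) := hcard ▸ hodd.pow
  have hirr := irreducible_cyclotomic_zmod_two hp hodd
    (orderOf_two_of_generates_prime_sq hp u hu hgen)
  have hcop {i : ℕ} (h1 : 1 ≤ i) (hi : i < p) : p.Coprime i :=
    Nat.coprime_of_lt_prime (by omega) hi hp
  have hpair {k : ℕ} {H K : Subgroup G} {x : G} (h : IsCocyclicPair p k H K x) (hk : k < n) :
      Module.finrank (ZMod 2) (Ideal.span {subgroupHat (ZMod 2) H - subgroupHat (ZMod 2) K}) =
        p ^ k * (p - 1) ∧
      HasCodeWeight (Ideal.span {subgroupHat (ZMod 2) H - subgroupHat (ZMod 2) K})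
        (2 * p ^ (n - k)) :=
    ⟨h.finrank_span hG hp hodd (hirr k), h.card_eq hp hcard hk ▸ h.hasCodeWeight hG⟩
  have hclasses := numMinimalCodeClasses_eq hp hodd hG hirr (by omega) ha hb hab
  refine ⟨fun I => ?_, ⟨finrank_codeZero hG, hcard ▸ hasCodeWeight_codeZero hG⟩, ?_, ?_, ?_,
    hclasses, hfin, hG, ?_⟩
  · rw [isMinimalCode_iff hp hodd hG hirr ha hb hab]
    constructor
    · rintro (h | ⟨k, hk, h⟩ | h | ⟨k, i, hk, hi1, hip, h⟩)
      · exact Or.inl h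
      · exact Or.inr (Or.inl ⟨k + 1, by omega, hk, h⟩)
      · exact Or.inr (Or.inr (Or.inl ⟨0, hp.pos, h⟩))
      -- The index is shifted by one: k = 0 with i ≥ 1 belongs to the family `codeKI p a b 1 i`,
      -- which also holds the separate case i = 0.
      · rcases k with _ | k
        · exact Or.inr (Or.inr (Or.inl ⟨i, hip, h⟩))
        · exact Or.inr (Or.inr (Or.inr ⟨k + 2, i, by omega, hk, hi1, hip, h⟩))
    · rintro (h | ⟨k, hk1, hk, h⟩ | ⟨i, hip, h⟩ | ⟨k, i, hk2, hk, hi1, hip, h⟩)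
      · exact Or.inl h
      · obtain ⟨k, rfl⟩ := Nat.exists_eq_add_of_le' hk1
        exact Or.inr (Or.inl ⟨k, hk, h⟩)
      · rcases i with _ | i
        · exact Or.inr (Or.inr (Or.inl h))
        · exact Or.inr (Or.inr (Or.inr ⟨0, i + 1, by omega, by omega, hip, h⟩))
      · obtain ⟨k, rfl⟩ := Nat.exists_eq_add_of_le' (show 1 ≤ k by omega)
        exact Or.inr (Or.inr (Or.inr ⟨k, i, hk, hi1, hip, h⟩))
  · intro k hk1 hk
    obtain ⟨k, rfl⟩ := Nat.exists_eq_add_of_le' hk1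
    rw [show n - (k + 1) + 1 = n - k by omega]
    exact hpair (isCocyclicPair_codeK hp ha hab hk) hk
  · intro i hip
    rcases i with _ | i
    · have := hpair (isCocyclicPair_codeKI_zero hp hb hab) (by omega)
      rw [pow_zero, one_mul, Nat.sub_zero] at this
      have heq : codeKI p a b 1 0 = Ideal.span {subgroupHat (ZMod 2) (Subgroup.zpowers a) -
          subgroupHat (ZMod 2) (Subgroup.zpowers a ⊔ Subgroup.zpowers b)} := by
        simp [codeKI]
      rw [heq]
      exact this
    · have := hpair (isCocyclicPair_codeKI (k := 0) hp ha hb hab (by omega)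
        (hcop (by omega) hip)) (by omega)
      rw [pow_zero, one_mul, Nat.sub_zero] at this
      exact this
  · intro k i hk2 hk hi1 hip
    obtain ⟨k, rfl⟩ := Nat.exists_eq_add_of_le' (show 1 ≤ k by omega)
    rw [show n - (k + 1) + 1 = n - k by omega]
    exact hpair (isCocyclicPair_codeKI hp ha hb hab hk (hcop hi1 hip)) hk
  -- The exponent `p ^ n` has n + 1 divisors, and n + 1 < 2n.
  · rw [hclasses, exponent_of_isCompl_zpowers (by rw [ha, hb]; exact dvd_pow_self p (by omega)) hab,
      ha, Nat.divisors_prime_pow hp, Finset.card_map, Finset.card_range]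
    omega
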